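/- Let $L^2(\mathbb{R})$ denote the Hilbert space of real-valued (respectively, complex-valued) square-integrable functions on $\mathbb{R}$, let $\mu$ be the Lebesgue measure, and let $\psi\in L^2(\mathbb{R})$ be band-limited, say $\operatorname{supp}\widehat{\psi}\subset[-\rho,\rho]$ for some $\rho\in\,]0,+\infty[$. For $(j,k)\in\mathbb{Z}^2$ set $\psi_{j,k}\colon t\mapsto 2^{j/2}\psi(2^jt-k)$. Suppose that $(\psi_{j,k})_{(j,k)\in\mathbb{Z}^2}$ is a frame for $L^2(\mathbb{R})$, i.e., there exist $\alpha,\beta\in\,]0,+\infty[$ such that $$(\forall x\in L^2(\mathbb{R}))\quad \alpha\|x\|^2\leq\sum_{j\in\mathbb{Z}}\sum_{k\in\mathbb{Z}}|\langle x,\psi_{j,k}\rangle|^2\leq\beta\|x\|^2,$$ and that it admits a lower Riesz bound $\gamma\in\,]0,+\infty[$, i.e., $$(\forall (c_{j,k})\in\ell^2(\mathbb{Z}^2))\quad \sum_{j\in\mathbb{Z}}\sum_{k\in\mathbb{Z}}|c_{j,k}|^2\leq\gamma\Big\|\sum_{j\in\mathbb{Z}}\sum_{k\in\mathbb{Z}}c_{j,k}\psi_{j,k}\Big\|^2.$$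 Let $A$ be a Lebesgue measurable subset of $\mathbb{R}$ such that $0<\mu(A)<+\infty$, let $J\in\mathbb{Z}$, and set $\Lambda=\{(j,k)\in\mathbb{Z}\times\mathbb{Z} : j\leq J\}$. Then, for every $y\in L^2(A)$ and every $(\eta_{j,k})_{(j,k)\in\Lambda}\in\ell^2(\Lambda)$ (with the same scalar field), there exists $x\in L^2(\mathbb{R})$ such that $$x|_A=y\ \text{ (almost everywhere on } A)\quad\text{and}\quad(\forall (j,k)\in\Lambda)\quad\langle x,\psi_{j,k}\rangle=\eta_{j,k}.$$ -/

import Mathlib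

open MeasureTheory FourierTransform

/-- The function `t ↦ 2^(j/2) ψ(2^j t - k)`. -/
noncomputable def waveletFun {𝕜 : Type*} [RCLike 𝕜] (ψ : ℝ → 𝕜) (j k : ℤ) (t : ℝ) : 𝕜 :=
  (2 : ℝ) ^ ((j : ℝ) / 2) • ψ ((2 : ℝ) ^ j * t - k)

theorem map_volume_dilate (j k : ℤ) :
    Measure.map (fun t : ℝ => (2 : ℝ) ^ j * t - k) volume =
      ENNReal.ofReal |((2 : ℝ) ^ j)⁻¹| • volume := by
  have h2 : (2 : ℝ) ^ j ≠ 0 := by positivity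
  have h : (fun t : ℝ => (2 : ℝ) ^ j * t - k) = (fun s : ℝ => s - k) ∘ (fun t => (2 : ℝ) ^ j * t) :=
    rfl
  rw [h, ← Measure.map_map (by fun_prop) (by fun_prop), Real.map_volume_mul_left h2,
    Measure.map_smul, (measurePreserving_sub_right volume (k : ℝ)).map_eq]

/-- Dyadic dilates and translates of a square-integrable function are square-integrable. -/
theorem memLp_waveletFun {𝕜 : Type*} [RCLike 𝕜] {ψ : ℝ → 𝕜} (hψ : MemLp ψ 2 volume) (j k : ℤ) :
    MemLp (waveletFun ψ j k) 2 volume := by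
  have h : MemLp (ψ ∘ fun t : ℝ => (2 : ℝ) ^ j * t - k) 2 volume := by
    refine MemLp.comp_of_map ?_ (by fun_prop)
    rw [map_volume_dilate]
    exact hψ.smul_measure ENNReal.ofReal_ne_top
  exact h.const_smul ((2 : ℝ) ^ ((j : ℝ) / 2))

/-- The element `ψ_{j,k}` of `L²(ℝ)`, that is, the class of `t ↦ 2^(j/2) ψ(2^j t - k)`. -/
noncomputable def wavelet {𝕜 : Type*} [RCLike 𝕜] (ψ : Lp 𝕜 2 (volume : Measure ℝ)) (j k : ℤ) :
    Lp 𝕜 2 (volume : Measure ℝ) :=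
  (memLp_waveletFun (Lp.memLp ψ) j k).toLp (waveletFun ψ j k)

/-- A real- or complex-valued element of `L²(ℝ)`, regarded as a complex-valued one. -/
noncomputable def toComplexL2 {𝕜 : Type*} [RCLike 𝕜] (x : Lp 𝕜 2 (volume : Measure ℝ)) :
    Lp ℂ 2 (volume : Measure ℝ) :=
  (RCLike.map 𝕜 ℂ).compLp x

/-- The (closed, essential) support of the `L²` Fourier transform of `x` is contained in
`[-ρ, ρ]`: the Fourier transform vanishes almost everywhere off that closed interval. -/
def FourierSupportedIn {𝕜 : Type*} [RCLike 𝕜] (x : Lp 𝕜 2 (volume : Measure ℝ)) (ρ : ℝ) : Prop :=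
  ∀ᵐ ξ : ℝ, ξ ∉ Set.Icc (-ρ) ρ → (𝓕 (toComplexL2 x) : Lp ℂ 2 (volume : Measure ℝ)) ξ = 0

/-- The family `f` satisfies the frame inequalities with bounds `α` and `β`. The sum is
required to converge, so that it is the sum of the series of nonnegative terms. -/
def HasFrameBounds (𝕜 : Type*) [RCLike 𝕜] {H ι : Type*} [NormedAddCommGroup H]
    [InnerProductSpace 𝕜 H] (f : ι → H) (α β : ℝ) : Prop :=
  ∀ x : H, Summable (fun i => ‖inner 𝕜 (f i) x‖ ^ 2) ∧
    α * ‖x‖ ^ 2 ≤ ∑' i, ‖inner 𝕜 (f i) x‖ ^ 2 ∧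
    ∑' i, ‖inner 𝕜 (f i) x‖ ^ 2 ≤ β * ‖x‖ ^ 2

/-- The family `f` has lower Riesz bound `γ`: for every square-summable family `c` for which
`∑ cᵢ fᵢ` converges (for a frame, this is every square-summable family), one has
`∑ |cᵢ|² ≤ γ ‖∑ cᵢ fᵢ‖²`. -/
def HasLowerRieszBound (𝕜 : Type*) [RCLike 𝕜] {H ι : Type*} [NormedAddCommGroup H]
    [InnerProductSpace 𝕜 H] (f : ι → H) (γ : ℝ) : Prop :=
  ∀ (c : lp (fun _ : ι => 𝕜) 2) (s : H), HasSum (fun i => c i • f i) s →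
    ∑' i, ‖c i‖ ^ 2 ≤ γ * ‖s‖ ^ 2

/-! Let `Y` be `y` extended by zero and look for `x` as `Y` plus a function `z` living on the
complement of `A`. The restrictions of `ψ_{j,k}` to `Aᶜ` must then have inner products `η_{j,k} -
⟨Y, ψ_{j,k}⟩` with `z`, and the frame upper bound makes these data square-summable. Such a moment
problem is solvable once the restricted family has a lower Riesz bound on finite combinations
(`exists_inner_eq_of_finsupp_sum_le`). That bound comes from an uncertainty principle. For `j ≤ J`
all `ψ_{j,k}` are band-limited to `[-2^J ρ, 2^J ρ]` (`FourierSupportedIn.wavelet`), hence so are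
their combinations `s`, and `δ‖s‖ ≤ ‖s|_{Aᶜ}‖` by `exists_pos_mul_norm_le_norm_restrict_compl`. Thus
restriction only degrades `γ` to `γ/δ²`. The uncertainty principle is a compactness argument: unit
band-limited functions concentrating on `A` would have a subsequence converging pointwise to the
restriction of an entire function that vanishes almost everywhere on `Aᶜ`, hence everywhere. Since
`A` has finite measure, dominated convergence then removes the mass on `A` as well. -/

/-! ### Fourier inversion and the Paley–Wiener representation. -/

-- Tested against a smooth compactly supported function, the `L²` inverse transform is the
-- distributional one, so it moves onto the test function; Fubini moves it back onto `g` as an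
-- integral.
open scoped ContDiff in
theorem fourierInv_Lp_ae_eq {g : Lp ℂ 2 (volume : Measure ℝ)} (hg : Integrable g) :
    ∀ᵐ t : ℝ, (𝓕⁻ g : Lp ℂ 2 (volume : Measure ℝ)) t = 𝓕⁻ (g : ℝ → ℂ) t := by
  have hcont : Continuous (𝓕⁻ (g : ℝ → ℂ)) :=
    VectorFourier.fourierIntegral_continuous Real.continuous_fourierChar
      (by simp only [LinearMap.neg_apply, innerₗ_apply_apply]; fun_prop) hg
  refine ae_eq_of_integral_contDiff_smul_eq
    ((Lp.memLp _).locallyIntegrable one_le_two) hcont.locallyIntegrable fun φ hφ hφc => ?_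
  have h₁ : HasCompactSupport (Complex.ofRealCLM ∘ φ) := hφc.comp_left rfl
  have h₂ : ContDiff ℝ ∞ (Complex.ofRealCLM ∘ φ) := by fun_prop
  set Φ := h₁.toSchwartzMap h₂ with hΦ
  have e₁ : ∫ t, φ t • (𝓕⁻ g : Lp ℂ 2 (volume : Measure ℝ)) t =
      Lp.toTemperedDistribution (𝓕⁻ g : Lp ℂ 2 (volume : Measure ℝ)) Φ := by
    simp [hΦ]
  rw [e₁, ← Lp.fourierInv_toTemperedDistribution_eq, TemperedDistribution.fourierInv_apply,
    Lp.toTemperedDistribution_apply, SchwartzMap.fourierInv_coe]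
  have := VectorFourier.integral_fourierIntegral_smul_eq_flip (L := -innerₗ ℝ)
    (μ := volume) (ν := volume) Real.continuous_fourierChar
    (by simp only [LinearMap.neg_apply, innerₗ_apply_apply]; fun_prop) Φ.integrable hg
  refine this.trans (integral_congr_ae (.of_forall fun t => ?_))
  have hflip : (-innerₗ ℝ : ℝ →ₗ[ℝ] ℝ →ₗ[ℝ] ℝ).flip = -innerₗ ℝ := by
    ext; simp
  simp only [hflip, hΦ]
  simp [FourierTransformInv.fourierInv]

/-- The entire function whose restriction to `ℝ` is the inverse Fourier transform of the truncation
of `g` to `[-R, R]`. -/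
noncomputable def bandIntegral (R : ℝ) (g : ℝ → ℂ) (z : ℂ) : ℂ :=
  ∫ ξ in Set.Icc (-R) R, Complex.exp (2 * Real.pi * Complex.I * z * ξ) * g ξ

theorem differentiable_bandIntegral {R : ℝ} {g : ℝ → ℂ}
    (hg : IntegrableOn g (Set.Icc (-R) R)) : Differentiable ℂ (bandIntegral R g) := by
  intro z₀
  have hc : ∀ z : ℂ, Continuous fun ξ : ℝ => Complex.exp (2 * Real.pi * Complex.I * z * ξ) := by
    intro z; fun_prop
  have hm : ∀ z : ℂ, AEStronglyMeasurable
      (fun ξ : ℝ => Complex.exp (2 * Real.pi * Complex.I * z * ξ) * g ξ)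
      (volume.restrict (Set.Icc (-R) R)) := fun z =>
    (hc z).aestronglyMeasurable.mul hg.aestronglyMeasurable
  have hexp : ∀ z : ℂ, ∀ ξ ∈ Set.Icc (-R) R, ‖Complex.exp (2 * Real.pi * Complex.I * z * ξ)‖ ≤
      Real.exp (2 * Real.pi * ‖z‖ * R) := by
    intro z ξ hξ
    rw [Complex.norm_exp]
    refine Real.exp_le_exp.2 ((Complex.re_le_norm _).trans ?_)
    have hξ' : |ξ| ≤ R := abs_le.2 hξ
    simp only [norm_mul, Complex.norm_real, Complex.norm_I, Real.norm_eq_abs,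
      abs_of_pos Real.pi_pos, mul_one, Complex.norm_ofNat]
    gcongr
  refine (hasDerivAt_integral_of_dominated_loc_of_deriv_le
    (F' := fun z ξ => (2 * Real.pi * Complex.I * ξ) *
      (Complex.exp (2 * Real.pi * Complex.I * z * ξ) * g ξ))
    -- The derivative is dominated uniformly on the unit ball around `z₀`, where `‖z‖ ≤ ‖z₀‖ + 1`.
    (bound := fun ξ => (2 * Real.pi * R) * (Real.exp (2 * Real.pi * (‖z₀‖ + 1) * R) * ‖g ξ‖))
    (Metric.ball_mem_nhds z₀ one_pos) (.of_forall hm) ?_ ?_ ?_ ?_ ?_).2.differentiableAt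
  · refine (hg.norm.const_mul (Real.exp (2 * Real.pi * ‖z₀‖ * R))).mono' (hm z₀) ?_
    refine (ae_restrict_mem measurableSet_Icc).mono fun ξ hξ => ?_
    rw [norm_mul]
    gcongr
    exact hexp z₀ ξ hξ
  · exact (by fun_prop : Continuous fun ξ : ℝ => 2 * Real.pi * Complex.I * (ξ : ℂ)).aestronglyMeasurable.mul
      (hm z₀)
  · refine (ae_restrict_mem measurableSet_Icc).mono fun ξ hξ z hz => ?_
    have hR : 0 ≤ R := by linarith [hξ.1, hξ.2]
    have hξ' : |ξ| ≤ R := abs_le.2 hξ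
    have hz' : ‖z‖ ≤ ‖z₀‖ + 1 := by
      have h1 : ‖z - z₀‖ < 1 := by simpa [dist_eq_norm] using hz
      linarith [norm_sub_norm_le z z₀]
    rw [norm_mul]
    have h2 : ‖(2 * Real.pi * Complex.I * ξ : ℂ)‖ ≤ 2 * Real.pi * R := by
      simp only [norm_mul, Complex.norm_real, Complex.norm_I, Real.norm_eq_abs,
        abs_of_pos Real.pi_pos, mul_one, Complex.norm_ofNat]
      gcongr
    have h3 : ‖Complex.exp (2 * Real.pi * Complex.I * z * ξ)‖ ≤
        Real.exp (2 * Real.pi * (‖z₀‖ + 1) * R) :=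
      (hexp z ξ hξ).trans (Real.exp_le_exp.2 (by gcongr))
    exact mul_le_mul h2 (by rw [norm_mul]; gcongr) (norm_nonneg _) (by positivity)
  · exact (hg.norm.const_mul _).const_mul _
  · refine .of_forall fun ξ z _ => ?_
    have h1 : HasDerivAt (fun z : ℂ => 2 * Real.pi * Complex.I * z * ξ)
        (2 * Real.pi * Complex.I * ξ) z := by
      simpa using ((hasDerivAt_id z).const_mul (2 * Real.pi * Complex.I : ℂ)).mul_const (ξ : ℂ)
    exact (h1.cexp.mul_const (g ξ)).congr_deriv (by ring)

/-- An entire function vanishing on a set of reals of positive measure is zero. -/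
theorem eq_zero_of_differentiable_of_volume_ne_zero {F : ℂ → ℂ} (hF : Differentiable ℂ F)
    {s : Set ℝ} (hs : volume s ≠ 0) (h0 : ∀ t ∈ s, F t = 0) : F = 0 := by
  -- Otherwise `s` would be discrete, hence countable and null.
  obtain ⟨t, -, ht⟩ : ∃ t ∈ s, AccPt t (Filter.principal s) := by
    by_contra! h
    have : DiscreteTopology s := by
      rw [discreteTopology_subtype_iff]
      intro x hx
      have := h x hx
      rwa [AccPt, Filter.not_neBot] at this
    have hc : Countable s := countable_of_Lindelof_of_discrete
    exact hs ((Set.countable_coe_iff.1 hc).measure_zero _)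
  refine AnalyticOnNhd.eq_of_frequently_eq (z₀ := (t : ℂ))
    (fun z _ => hF.analyticAt z) (fun z _ => analyticAt_const) ?_
  rw [accPt_iff_frequently_nhdsNE] at ht
  have htend : Filter.Tendsto (fun x : ℝ => (x : ℂ)) (nhdsWithin t {t}ᶜ)
      (nhdsWithin (t : ℂ) {(t : ℂ)}ᶜ) :=
    tendsto_nhdsWithin_of_tendsto_nhds_of_eventually_within _
      (Complex.continuous_ofReal.continuousAt.tendsto.mono_left nhdsWithin_le_nhds)
      (eventually_mem_nhdsWithin.mono fun x hx => by simpa using hx)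
  exact htend.frequently (ht.mono fun x hx => by simpa using h0 x hx)

theorem norm_exp_two_pi_I_mul (t ξ : ℝ) :
    ‖Complex.exp (2 * Real.pi * Complex.I * t * ξ)‖ = 1 := by
  rw [show (2 * Real.pi * Complex.I * t * ξ : ℂ) = ((2 * Real.pi * t * ξ : ℝ) : ℂ) * Complex.I by
    push_cast; ring]
  exact Complex.norm_exp_ofReal_mul_I _

theorem memLp_bandKernel (R t : ℝ) :
    MemLp ((Set.Icc (-R) R).indicator
      fun ξ : ℝ => (starRingEnd ℂ) (Complex.exp (2 * Real.pi * Complex.I * t * ξ))) 2 volume := by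
  rw [memLp_indicator_iff_restrict measurableSet_Icc]
  refine MemLp.of_bound (Continuous.aestronglyMeasurable (by fun_prop)) 1 (.of_forall fun ξ => ?_)
  rw [RCLike.norm_conj, norm_exp_two_pi_I_mul]

/-- The element of `L²(ℝ)` representing the evaluation of `bandIntegral R` at the real point `t`. -/
noncomputable def bandKernel (R t : ℝ) : Lp ℂ 2 (volume : Measure ℝ) :=
  (memLp_bandKernel R t).toLp _

/-- This makes weak convergence of Fourier transforms imply pointwise convergence of band-limited
functions. The conjugate in the kernel undoes the one in the first slot of the inner product. -/
theorem inner_bandKernel (R t : ℝ) (g : Lp ℂ 2 (volume : Measure ℝ)) :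
    inner ℂ (bandKernel R t) g = bandIntegral R g t := by
  rw [L2.inner_def, bandIntegral, ← integral_indicator measurableSet_Icc]
  refine integral_congr_ae ?_
  filter_upwards [(memLp_bandKernel R t).coeFn_toLp] with ξ hξ
  rw [bandKernel, hξ]
  by_cases h : ξ ∈ Set.Icc (-R) R <;> simp [h, mul_comm]

/-- The modulus of the kernel does not depend on `t`; this supplies the constant dominating function
on `A`. -/
theorem norm_bandKernel_le (R t : ℝ) : ‖bandKernel R t‖ ≤ ‖bandKernel R 0‖ := by
  refine Lp.norm_le_norm_of_ae_le ?_
  filter_upwards [(memLp_bandKernel R t).coeFn_toLp, (memLp_bandKernel R 0).coeFn_toLp] with ξ h h0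
  rw [bandKernel, bandKernel, h, h0, norm_indicator_eq_indicator_norm,
    norm_indicator_eq_indicator_norm]
  simp only [RCLike.norm_conj, norm_exp_two_pi_I_mul, le_refl]

theorem integrableOn_Icc_of_Lp (R : ℝ) (g : Lp ℂ 2 (volume : Measure ℝ)) :
    IntegrableOn g (Set.Icc (-R) R) :=
  ((Lp.memLp g).restrict _).integrable one_le_two

theorem integrable_of_ae_zero_off {R : ℝ} {g : Lp ℂ 2 (volume : Measure ℝ)}
    (h : ∀ᵐ ξ : ℝ, ξ ∉ Set.Icc (-R) R → g ξ = 0) : Integrable g :=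
  (integrableOn_Icc_of_Lp R g).integrable_of_ae_notMem_eq_zero h

/-- Paley–Wiener representation of band-limited functions. -/
theorem ae_eq_bandIntegral {R : ℝ} {f : Lp ℂ 2 (volume : Measure ℝ)}
    (h : ∀ᵐ ξ : ℝ, ξ ∉ Set.Icc (-R) R → (𝓕 f : Lp ℂ 2 (volume : Measure ℝ)) ξ = 0) :
    ∀ᵐ t : ℝ, f t = bandIntegral R (𝓕 f : Lp ℂ 2 (volume : Measure ℝ)) t := by
  have h1 := fourierInv_Lp_ae_eq (integrable_of_ae_zero_off h)
  rw [fourierInv_fourier_eq] at h1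
  filter_upwards [h1] with t ht
  rw [ht, Real.fourierInv_eq', bandIntegral]
  rw [setIntegral_eq_integral_of_ae_compl_eq_zero]
  · refine integral_congr_ae (.of_forall fun ξ => ?_)
    simp only [smul_eq_mul, RCLike.inner_apply]
    congr 2
    simp
    ring
  · filter_upwards [h] with ξ hξ hξ'
    simp [hξ hξ']

/-! ### The uncertainty principle for band-limited functions. -/

/-- Bounded sequences in a separable Hilbert space have weakly convergent subsequences. -/
theorem exists_subseq_tendsto_inner {H : Type*} [NormedAddCommGroup H] [InnerProductSpace ℂ H]
    [CompleteSpace H] [TopologicalSpace.SeparableSpace H] (g : ℕ → H) (C : ℝ)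
    (hg : ∀ n, ‖g n‖ ≤ C) :
    ∃ (g₀ : H) (φ : ℕ → ℕ), StrictMono φ ∧ ∀ h : H,
      Filter.Tendsto (fun n => inner ℂ h (g (φ n))) Filter.atTop (nhds (inner ℂ h g₀)) := by
  obtain ⟨L, -, φ, hφ, hL⟩ := WeakDual.isSeqCompact_closedBall ℂ H 0 C
    (x := fun n => StrongDual.toWeakDual (InnerProductSpace.toDual ℂ H (g n)))
    (fun n => by simpa using hg n)
  refine ⟨(InnerProductSpace.toDual ℂ H).symm (WeakDual.toStrongDual L), φ, hφ, fun h => ?_⟩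
  have h1 := ((WeakDual.eval_continuous h).tendsto L).comp hL
  have h2 := (Complex.continuous_conj.tendsto _).comp h1
  rw [← inner_conj_symm h, InnerProductSpace.toDual_symm_apply]
  refine h2.congr fun n => ?_
  simp only [Function.comp_apply]
  rw [← inner_conj_symm h]
  rfl

theorem enorm_sq_eq_lintegral {X E : Type*} [MeasurableSpace X] [NormedAddCommGroup E]
    {μ : Measure X} (f : Lp E 2 μ) : ‖f‖ₑ ^ 2 = ∫⁻ t, ‖f t‖ₑ ^ 2 ∂μ := by
  have := eLpNorm_nnreal_pow_eq_lintegral (f := f) (μ := μ) (p := 2) two_ne_zero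
  rw [Lp.enorm_def]
  rw [← ENNReal.rpow_two]
  simpa only [NNReal.coe_ofNat, ENNReal.coe_ofNat, ENNReal.rpow_two] using this

/-- A sequence of band-limited functions of norm one cannot concentrate on a set of finite
measure. -/
theorem not_tendsto_norm_restrict_compl {R : ℝ} {A : Set ℝ} (hA : MeasurableSet A)
    (hAtop : volume A < ⊤) (u : ℕ → Lp ℂ 2 (volume : Measure ℝ)) (hu : ∀ n, ‖u n‖ = 1)
    (hsupp : ∀ n, ∀ᵐ ξ : ℝ, ξ ∉ Set.Icc (-R) R →
      (𝓕 (u n) : Lp ℂ 2 (volume : Measure ℝ)) ξ = 0) :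
    ¬ Filter.Tendsto (fun n => ‖LpToLpRestrictCLM ℝ ℂ ℂ volume 2 Aᶜ (u n)‖)
      Filter.atTop (nhds 0) := by
  intro hres
  have : Fact ((2 : ENNReal) ≠ ⊤) := ⟨by simp⟩
  obtain ⟨g₀, φ, hφ, hweak⟩ := exists_subseq_tendsto_inner
    (fun n => (𝓕 (u n) : Lp ℂ 2 (volume : Measure ℝ))) 1 (fun n => by simp [hu])
  set F : ℕ → ℝ → ℂ := fun n t => bandIntegral R (𝓕 (u (φ n)) : Lp ℂ 2 (volume : Measure ℝ)) t
    with hF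
  set F₀ : ℝ → ℂ := fun t => bandIntegral R g₀ t with hF₀
  have hlim : ∀ t, Filter.Tendsto (fun n => F n t) Filter.atTop (nhds (F₀ t)) := fun t => by
    simpa only [inner_bandKernel] using hweak (bandKernel R t)
  have hlim2 : ∀ t, Filter.Tendsto (fun n => ‖F n t‖ₑ ^ 2) Filter.atTop (nhds (‖F₀ t‖ₑ ^ 2)) :=
    fun t => ((ENNReal.continuous_pow 2).tendsto _).comp (hlim t).enorm
  have hbd : ∀ n t, ‖F n t‖ₑ ≤ ‖bandKernel R 0‖ₑ := fun n t => by
    rw [enorm_le_iff_norm_le, hF]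
    simp only [← inner_bandKernel]
    refine (norm_inner_le_norm _ _).trans ?_
    simpa [hu] using norm_bandKernel_le R t
  have hcont : ∀ g : Lp ℂ 2 (volume : Measure ℝ), Continuous fun t : ℝ => bandIntegral R g t :=
    fun g => (differentiable_bandIntegral (integrableOn_Icc_of_Lp R g)).continuous.comp
      Complex.continuous_ofReal
  have hmeas : ∀ n, Measurable fun t => ‖F n t‖ₑ ^ 2 := fun n =>
    ((hcont _).measurable.enorm).pow_const 2
  have haeF : ∀ n, ∀ᵐ t, u (φ n) t = F n t := fun n => ae_eq_bandIntegral (hsupp _)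
  have hcompl : Filter.Tendsto (fun n => ∫⁻ t in Aᶜ, ‖F n t‖ₑ ^ 2) Filter.atTop (nhds 0) := by
    have h1 : ∀ n, ∫⁻ t in Aᶜ, ‖F n t‖ₑ ^ 2 =
        ‖LpToLpRestrictCLM ℝ ℂ ℂ volume 2 Aᶜ (u (φ n))‖ₑ ^ 2 := fun n => by
      rw [enorm_sq_eq_lintegral]
      refine lintegral_congr_ae ?_
      filter_upwards [LpToLpRestrictCLM_coeFn ℂ Aᶜ (u (φ n)), ae_restrict_of_ae (haeF n)]
        with t h1 h2
      rw [h1, h2]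
    simp_rw [h1]
    have h2 := (ENNReal.tendsto_ofReal hres).comp hφ.tendsto_atTop
    have h3 := ((ENNReal.continuous_pow 2).tendsto _).comp h2
    simpa [Function.comp_def] using h3
  -- Fatou's lemma on `Aᶜ`.
  have hzero : ∀ᵐ t ∂volume.restrict Aᶜ, F₀ t = 0 := by
    have h1 : ∫⁻ t in Aᶜ, ‖F₀ t‖ₑ ^ 2 = 0 := by
      refine le_antisymm ?_ zero_le
      calc ∫⁻ t in Aᶜ, ‖F₀ t‖ₑ ^ 2
          = ∫⁻ t in Aᶜ, Filter.liminf (fun n => ‖F n t‖ₑ ^ 2) Filter.atTop := by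
            simp_rw [(hlim2 _).liminf_eq]
        _ ≤ Filter.liminf (fun n => ∫⁻ t in Aᶜ, ‖F n t‖ₑ ^ 2) Filter.atTop :=
            lintegral_liminf_le hmeas
        _ = 0 := hcompl.liminf_eq
    rw [lintegral_eq_zero_iff (((hcont _).measurable.enorm).pow_const 2)] at h1
    filter_upwards [h1] with t ht
    simpa using ht
  have hF₀zero : ∀ t, F₀ t = 0 := by
    -- If this set were null, so would be `Aᶜ`, and the line would have finite measure.
    have hne : volume {t ∈ Aᶜ | F₀ t = 0} ≠ 0 := by
      intro h0
      have h1 : volume Aᶜ = 0 := by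
        rw [ae_restrict_iff' hA.compl] at hzero
        refine measure_mono_null_ae ?_ h0
        filter_upwards [hzero] with t ht htA using ⟨htA, ht htA⟩
      have h2 := measure_add_measure_compl (μ := (volume : Measure ℝ)) hA
      rw [h1, add_zero, Real.volume_univ] at h2
      exact hAtop.ne h2
    intro t
    have := eq_zero_of_differentiable_of_volume_ne_zero
      (differentiable_bandIntegral (integrableOn_Icc_of_Lp R g₀)) hne (fun t ht => ht.2)
    exact congrFun this t
  have hin : Filter.Tendsto (fun n => ∫⁻ t in A, ‖F n t‖ₑ ^ 2) Filter.atTop (nhds 0) := by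
    have h1 := tendsto_lintegral_of_dominated_convergence (μ := volume.restrict A)
      (fun _ => ‖bandKernel R 0‖ₑ ^ 2) hmeas
      (fun n => .of_forall fun t => pow_le_pow_left₀ zero_le (hbd n t) 2)
      (by simpa using ENNReal.mul_ne_top (by simp) hAtop.ne)
      (.of_forall hlim2)
    simpa [hF₀zero] using h1
  have hsum : ∀ n, (∫⁻ t in A, ‖F n t‖ₑ ^ 2) + ∫⁻ t in Aᶜ, ‖F n t‖ₑ ^ 2 = 1 := fun n => by
    rw [lintegral_add_compl _ hA]
    calc ∫⁻ t, ‖F n t‖ₑ ^ 2 = ∫⁻ t, ‖u (φ n) t‖ₑ ^ 2 := by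
          refine lintegral_congr_ae ?_
          filter_upwards [haeF n] with t ht
          rw [ht]
      _ = ‖u (φ n)‖ₑ ^ 2 := (enorm_sq_eq_lintegral _).symm
      _ = 1 := by rw [← ofReal_norm, hu]; simp
  have := hin.add hcompl
  simp only [hsum, add_zero] at this
  exact one_ne_zero (tendsto_nhds_unique tendsto_const_nhds this)

/-- A quantitative uncertainty principle: band-limited functions cannot have almost all of their
energy in a set of finite measure. -/
theorem exists_pos_mul_norm_le_norm_restrict_compl (R : ℝ) {A : Set ℝ} (hA : MeasurableSet A)
    (hAtop : volume A < ⊤) :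
    ∃ δ : ℝ, 0 < δ ∧ ∀ f : Lp ℂ 2 (volume : Measure ℝ),
      (∀ᵐ ξ : ℝ, ξ ∉ Set.Icc (-R) R → (𝓕 f : Lp ℂ 2 (volume : Measure ℝ)) ξ = 0) →
      δ * ‖f‖ ≤ ‖LpToLpRestrictCLM ℝ ℂ ℂ volume 2 Aᶜ f‖ := by
  by_contra! h
  choose f hf hlt using fun n : ℕ => h (1 / ((n : ℝ) + 1)) (by positivity)
  have hpos : ∀ n, 0 < ‖f n‖ := fun n => by
    have := (norm_nonneg _).trans_lt (hlt n)
    exact pos_of_mul_pos_right this (by positivity)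
  refine not_tendsto_norm_restrict_compl hA hAtop (R := R)
    (fun n => ((‖f n‖⁻¹ : ℝ) : ℂ) • f n) (fun n => ?_) (fun n => ?_) ?_
  · rw [norm_smul, Complex.norm_real, norm_inv, norm_norm, inv_mul_cancel₀ (hpos n).ne']
  · rw [FourierTransform.fourier_smul]
    filter_upwards [hf n, Lp.coeFn_smul ((‖f n‖⁻¹ : ℝ) : ℂ) (𝓕 (f n))] with ξ h1 h2 hξ
    rw [h2, Pi.smul_apply, h1 hξ, smul_zero]
  · refine squeeze_zero (fun n => norm_nonneg _) (fun n => ?_) tendsto_one_div_add_atTop_nhds_zero_nat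
    rw [map_smul, norm_smul, Complex.norm_real, norm_inv, norm_norm, inv_mul_le_iff₀ (hpos n),
      mul_comm]
    exact (hlt n).le

/-! ### Real and complex scalars, and the bands of the wavelets. -/

section RCLikeMap

variable {𝕜 : Type*} [RCLike 𝕜]

theorem rclikeMap_mul (a b : 𝕜) :
    RCLike.map 𝕜 ℂ (a * b) = RCLike.map 𝕜 ℂ a * RCLike.map 𝕜 ℂ b := by
  -- Real scalars (`I = 0`) or complex scalars (`I * I = -1`).
  rcases RCLike.I_mul_I_ax (K := 𝕜) with h0 | h1
  · have him : ∀ z : 𝕜, RCLike.im z = 0 := fun z => by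
      rw [← RCLike.mul_im_I_ax z, show (RCLike.I : 𝕜) = 0 from h0, map_zero, mul_zero]
    apply Complex.ext <;> simp [him]
  · apply Complex.ext <;> simp

theorem norm_rclikeMap (a : 𝕜) : ‖RCLike.map 𝕜 ℂ a‖ = ‖a‖ := by
  rw [← sq_eq_sq₀ (norm_nonneg _) (norm_nonneg _), ← RCLike.normSq_eq_def', ← RCLike.normSq_eq_def',
    RCLike.normSq_apply, RCLike.normSq_apply]
  simp

theorem toComplexL2_add (x y : Lp 𝕜 2 (volume : Measure ℝ)) :
    toComplexL2 (x + y) = toComplexL2 x + toComplexL2 y :=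
  map_add ((RCLike.map 𝕜 ℂ).compLpₗ 2 volume) x y

theorem toComplexL2_smul (c : 𝕜) (x : Lp 𝕜 2 (volume : Measure ℝ)) :
    toComplexL2 (c • x) = RCLike.map 𝕜 ℂ c • toComplexL2 x := by
  refine Lp.ext ?_
  filter_upwards [(RCLike.map 𝕜 ℂ).coeFn_compLp (c • x), (RCLike.map 𝕜 ℂ).coeFn_compLp x,
    Lp.coeFn_smul c x, Lp.coeFn_smul (RCLike.map 𝕜 ℂ c) (toComplexL2 x)] with t h1 h2 h3 h4
  rw [h4, Pi.smul_apply, toComplexL2, h1, h3, Pi.smul_apply, toComplexL2, h2, smul_eq_mul,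
    smul_eq_mul, rclikeMap_mul]

theorem norm_toComplexL2 (x : Lp 𝕜 2 (volume : Measure ℝ)) : ‖toComplexL2 x‖ = ‖x‖ := by
  rw [Lp.norm_def, Lp.norm_def]
  congr 1
  refine eLpNorm_congr_norm_ae ?_
  filter_upwards [(RCLike.map 𝕜 ℂ).coeFn_compLp x] with t h
  rw [toComplexL2, h, norm_rclikeMap]

theorem norm_restrict_toComplexL2 (B : Set ℝ) (x : Lp 𝕜 2 (volume : Measure ℝ)) :
    ‖LpToLpRestrictCLM ℝ ℂ ℂ volume 2 B (toComplexL2 x)‖ =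
      ‖LpToLpRestrictCLM ℝ 𝕜 𝕜 volume 2 B x‖ := by
  rw [Lp.norm_def, Lp.norm_def]
  congr 1
  refine eLpNorm_congr_norm_ae ?_
  filter_upwards [ae_restrict_of_ae ((RCLike.map 𝕜 ℂ).coeFn_compLp x),
    LpToLpRestrictCLM_coeFn 𝕜 B x, LpToLpRestrictCLM_coeFn ℂ B (toComplexL2 x)] with t h1 h2 h3
  rw [h2, h3, toComplexL2, h1, norm_rclikeMap]

variable (𝕜) in
/-- The subspace of `L²(ℝ)` of functions band-limited to `[-R, R]`. -/
def bandLimited (R : ℝ) : Submodule 𝕜 (Lp 𝕜 2 (volume : Measure ℝ)) where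
  carrier := {x | FourierSupportedIn x R}
  zero_mem' := by
    have h : toComplexL2 (0 : Lp 𝕜 2 (volume : Measure ℝ)) = 0 :=
      map_zero ((RCLike.map 𝕜 ℂ).compLpₗ 2 volume)
    simp only [Set.mem_ofPred_eq, FourierSupportedIn, h, FourierTransform.fourier_zero]
    filter_upwards [Lp.coeFn_zero ℂ 2 (volume : Measure ℝ)] with ξ h _ using h
  add_mem' {x y} hx hy := by
    simp only [Set.mem_ofPred_eq, FourierSupportedIn, toComplexL2_add, FourierTransform.fourier_add]
    filter_upwards [hx, hy, Lp.coeFn_add (𝓕 (toComplexL2 x)) (𝓕 (toComplexL2 y))]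
      with ξ h1 h2 h3 hξ
    rw [h3, Pi.add_apply, h1 hξ, h2 hξ, add_zero]
  smul_mem' c x hx := by
    simp only [Set.mem_ofPred_eq, FourierSupportedIn, toComplexL2_smul,
      FourierTransform.fourier_smul]
    filter_upwards [hx, Lp.coeFn_smul (RCLike.map 𝕜 ℂ c) (𝓕 (toComplexL2 x))] with ξ h1 h2 hξ
    rw [h2, Pi.smul_apply, h1 hξ, smul_zero]

theorem FourierSupportedIn.mono {x : Lp 𝕜 2 (volume : Measure ℝ)} {R S : ℝ}
    (hx : FourierSupportedIn x R) (h : R ≤ S) : FourierSupportedIn x S := by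
  filter_upwards [hx] with ξ hξ hn
  exact hξ fun hm => hn (Set.Icc_subset_Icc (neg_le_neg h) h hm)

theorem ae_comp_dilate {p : ℝ → Prop} (h : ∀ᵐ s : ℝ, p s) (j k : ℤ) :
    ∀ᵐ t : ℝ, p ((2 : ℝ) ^ j * t - k) := by
  refine ae_of_ae_map (μ := volume) (f := fun t : ℝ => (2 : ℝ) ^ j * t - k) (by fun_prop) ?_
  rw [map_volume_dilate]
  exact Measure.ae_smul_measure h _

/-- The wavelet `ψ_{j,k}` has its band scaled by `2^j`. -/
theorem FourierSupportedIn.wavelet {ψ : Lp 𝕜 2 (volume : Measure ℝ)} {ρ : ℝ}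
    (hψ : FourierSupportedIn ψ ρ) (j k : ℤ) :
    FourierSupportedIn (wavelet ψ j k) ((2 : ℝ) ^ j * ρ) := by
  set g : Lp ℂ 2 (volume : Measure ℝ) := 𝓕 (toComplexL2 ψ) with hg
  have ha : (0 : ℝ) < 2 ^ j := by positivity
  -- The expected transform of `ψ_{j,k}`: a modulation by `-k 2^{-j}` times the transform of `ψ`
  -- dilated by `2^{-j}`. It is confirmed below by inverting it.
  set G₀ : ℝ → ℂ := fun ξ => Complex.exp (2 * Real.pi * Complex.I * (-(k * ((2 : ℝ) ^ j)⁻¹) : ℝ) * ξ) *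
    waveletFun g (-j) 0 ξ with hG₀
  have hG₀mem : MemLp G₀ 2 volume := by
    have h1 := memLp_waveletFun (Lp.memLp g) (-j) 0
    refine h1.of_le ((Continuous.aestronglyMeasurable (by fun_prop)).mul h1.aestronglyMeasurable)
      (.of_forall fun ξ => ?_)
    rw [norm_mul, norm_exp_two_pi_I_mul, one_mul]
  set G : Lp ℂ 2 (volume : Measure ℝ) := hG₀mem.toLp G₀ with hG
  have hGeq : ∀ᵐ ξ, G ξ = G₀ ξ := hG₀mem.coeFn_toLp
  have hGsupp : ∀ᵐ ξ : ℝ, ξ ∉ Set.Icc (-((2 : ℝ) ^ j * ρ)) ((2 : ℝ) ^ j * ρ) → G ξ = 0 := by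
    filter_upwards [hGeq, ae_comp_dilate hψ (-j) 0] with ξ h1 h2 hξ
    rw [h1, hG₀]
    simp only [waveletFun, hg]
    rw [h2, smul_zero, mul_zero]
    intro hm
    apply hξ
    simp only [Int.cast_zero, sub_zero, zpow_neg, Set.mem_Icc] at hm
    constructor
    · have := mul_le_mul_of_nonneg_left hm.1 ha.le
      rwa [mul_inv_cancel_left₀ ha.ne', mul_neg] at this
    · have := mul_le_mul_of_nonneg_left hm.2 ha.le
      rwa [mul_inv_cancel_left₀ ha.ne'] at this
  have hf : ∀ᵐ s, toComplexL2 ψ s = 𝓕⁻ (g : ℝ → ℂ) s := by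
    have := fourierInv_Lp_ae_eq (integrable_of_ae_zero_off hψ)
    rwa [fourierInv_fourier_eq] at this
  have hcalc : ∀ t : ℝ, 𝓕⁻ (G : ℝ → ℂ) t =
      ((2 : ℝ) ^ ((j : ℝ) / 2)) • 𝓕⁻ (g : ℝ → ℂ) ((2 : ℝ) ^ j * t - k) := by
    intro t
    rw [Real.fourierInv_congr_ae hGeq, Real.fourierInv_eq', Real.fourierInv_eq']
    have h1 := Measure.integral_comp_mul_left (fun s : ℝ =>
      Complex.exp (((2 * Real.pi * inner ℝ s ((2 : ℝ) ^ j * t - k) : ℝ) : ℂ) * Complex.I) • g s)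
      ((2 : ℝ) ^ j)⁻¹
    rw [inv_inv, abs_of_pos ha] at h1
    -- The Jacobian `2^j` times the normalization `2^{-j/2}` of `G₀`.
    have h2 : (2 : ℝ) ^ ((j : ℝ) / 2) = (2 : ℝ) ^ (((-j : ℤ) : ℝ) / 2) * (2 : ℝ) ^ j := by
      rw [← Real.rpow_intCast, ← Real.rpow_add two_pos]
      congr 1
      push_cast
      ring
    rw [h2, mul_smul, ← h1, ← integral_smul]
    refine integral_congr_ae (.of_forall fun ξ => ?_)
    simp only [hG₀, waveletFun, smul_eq_mul, zpow_neg, Int.cast_zero, sub_zero]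
    rw [mul_smul_comm, mul_smul_comm, ← mul_assoc, ← Complex.exp_add]
    congr 3
    simp only [RCLike.inner_apply, conj_trivial]
    have ha' : ((2 : ℂ) ^ j) ≠ 0 := zpow_ne_zero _ two_ne_zero
    push_cast
    field_simp
    ring
  have hinv : (𝓕⁻ G : Lp ℂ 2 (volume : Measure ℝ)) = toComplexL2 (_root_.wavelet ψ j k) := by
    refine Lp.ext ?_
    filter_upwards [fourierInv_Lp_ae_eq (integrable_of_ae_zero_off hGsupp),
      (RCLike.map 𝕜 ℂ).coeFn_compLp (_root_.wavelet ψ j k),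
      (memLp_waveletFun (Lp.memLp ψ) j k).coeFn_toLp,
      ae_comp_dilate ((RCLike.map 𝕜 ℂ).coeFn_compLp ψ) j k, ae_comp_dilate hf j k]
      with t h1 h2 h3 h4 h5
    rw [h1, hcalc, ← h5, toComplexL2, toComplexL2, h2, h4, _root_.wavelet, h3, waveletFun, map_smul]
  rw [FourierSupportedIn, ← hinv, fourier_fourierInv_eq]
  exact hGsupp

/-- The uncertainty principle on the subspace of band-limited functions. -/
theorem exists_pos_mul_norm_le_of_mem_bandLimited (R : ℝ) {A : Set ℝ} (hA : MeasurableSet A)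
    (hAtop : volume A < ⊤) :
    ∃ δ : ℝ, 0 < δ ∧ ∀ x ∈ bandLimited 𝕜 R,
      δ * ‖x‖ ≤ ‖LpToLpRestrictCLM ℝ 𝕜 𝕜 volume 2 Aᶜ x‖ := by
  obtain ⟨δ, hδ, h⟩ := exists_pos_mul_norm_le_norm_restrict_compl R hA hAtop
  refine ⟨δ, hδ, fun x hx => ?_⟩
  rw [← norm_toComplexL2, ← norm_restrict_toComplexL2]
  exact h _ hx

end RCLikeMap

/-! ### Moment problems from lower Riesz bounds. -/

section MomentProblem

variable {𝕜 : Type*} [RCLike 𝕜] {H ι : Type*} [NormedAddCommGroup H] [InnerProductSpace 𝕜 H]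

theorem HasLowerRieszBound.finsupp_sum_le {f : ι → H} {γ : ℝ} (hf : HasLowerRieszBound 𝕜 f γ)
    (c : ι →₀ 𝕜) :
    c.sum (fun _ a => ‖a‖ ^ 2) ≤ γ * ‖Finsupp.linearCombination 𝕜 f c‖ ^ 2 := by
  have hmem : Memℓp (⇑c : ι → 𝕜) 2 :=
    (memℓp_zero (c.hasFiniteSupport.subset fun i hi => hi)).of_exponent_ge zero_le
  obtain ⟨d, hd⟩ : ∃ d : lp (fun _ : ι => 𝕜) 2, ∀ i, d i = c i := ⟨⟨⇑c, hmem⟩, fun _ => rfl⟩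
  have h := hf d (Finsupp.linearCombination 𝕜 f c) (by
    rw [Finsupp.linearCombination_apply, Finsupp.sum]
    simp only [hd]
    refine hasSum_sum_of_ne_finset_zero fun i hi => ?_
    rw [Finsupp.notMem_support_iff.1 hi, zero_smul])
  simp only [hd] at h
  rwa [tsum_eq_sum (s := c.support) (fun i hi => by
    rw [Finsupp.notMem_support_iff.1 hi]; simp)] at h

/-- A family with a lower Riesz bound on finite combinations solves every square-summable moment
problem. -/
theorem exists_inner_eq_of_finsupp_sum_le [CompleteSpace H] (f : ι → H) {M : ℝ} (hM : 0 ≤ M)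
    (hf : ∀ c : ι →₀ 𝕜, c.sum (fun _ a => ‖a‖ ^ 2) ≤ M * ‖Finsupp.linearCombination 𝕜 f c‖ ^ 2)
    (ζ : ι → 𝕜) (hζ : Summable fun i => ‖ζ i‖ ^ 2) :
    ∃ z : H, ∀ i, inner 𝕜 (f i) z = ζ i := by
  set D := Finsupp.linearCombination 𝕜 f with hD
  set ℓ := Finsupp.linearCombination 𝕜 (fun i => (starRingEnd 𝕜) (ζ i)) with hℓ
  have hinj : Function.Injective D := by
    rw [injective_iff_map_eq_zero]
    intro c hc
    have h := hf c
    rw [hc, norm_zero, zero_pow two_ne_zero, mul_zero, Finsupp.sum] at h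
    have h0 := (Finset.sum_eq_zero_iff_of_nonneg (fun i _ => by positivity)).1
      (le_antisymm h (Finset.sum_nonneg fun i _ => by positivity))
    ext i
    by_contra hi
    exact hi (by simpa using h0 i (Finsupp.mem_support_iff.2 hi))
  -- By Cauchy–Schwarz, `D c ↦ ℓ c` is a bounded functional on the span of `f`, well defined since
  -- `D` is injective. Hahn–Banach extends it and the Riesz representation gives `z`.
  have hbound : ∀ c, ‖ℓ c‖ ≤ √(M * ∑' i, ‖ζ i‖ ^ 2) * ‖D c‖ := by
    intro c
    refine abs_le_of_sq_le_sq' ?_ (by positivity) |>.2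
    rw [mul_pow, Real.sq_sqrt (mul_nonneg hM (tsum_nonneg fun i => by positivity))]
    have h1 : ‖ℓ c‖ ≤ ∑ i ∈ c.support, ‖c i‖ * ‖ζ i‖ := by
      rw [hℓ, Finsupp.linearCombination_apply, Finsupp.sum]
      refine (norm_sum_le _ _).trans (Finset.sum_le_sum fun i _ => ?_)
      rw [smul_eq_mul, norm_mul, RCLike.norm_conj]
    calc ‖ℓ c‖ ^ 2 ≤ (∑ i ∈ c.support, ‖c i‖ * ‖ζ i‖) ^ 2 := by gcongr
      _ ≤ (∑ i ∈ c.support, ‖c i‖ ^ 2) * ∑ i ∈ c.support, ‖ζ i‖ ^ 2 :=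
          Finset.sum_mul_sq_le_sq_mul_sq _ _ _
      _ ≤ (M * ‖D c‖ ^ 2) * ∑' i, ‖ζ i‖ ^ 2 :=
          mul_le_mul (hf c) (hζ.sum_le_tsum _ fun i _ => by positivity)
            (Finset.sum_nonneg fun i _ => by positivity) (by positivity)
      _ = M * (∑' i, ‖ζ i‖ ^ 2) * ‖D c‖ ^ 2 := by ring
  set e := LinearEquiv.ofInjective D hinj with he
  obtain ⟨g, hg, -⟩ := exists_extension_norm_eq (LinearMap.range D)
    ((ℓ ∘ₗ e.symm.toLinearMap).mkContinuous (√(M * ∑' i, ‖ζ i‖ ^ 2)) (fun x => by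
      have hx : D (e.symm x) = x := congrArg Subtype.val (e.apply_symm_apply x)
      simpa [hx] using hbound (e.symm x)))
  refine ⟨(InnerProductSpace.toDual 𝕜 H).symm g, fun i => ?_⟩
  rw [← inner_conj_symm, InnerProductSpace.toDual_symm_apply]
  have h1 : f i = (e (Finsupp.single i 1) : H) := by
    rw [he, LinearEquiv.ofInjective_apply, hD, Finsupp.linearCombination_single, one_smul]
  rw [h1, hg]
  simp [hℓ]

end MomentProblem

/-! ### Interpolation on `A` with prescribed coefficients. -/

section Interpolation

variable {𝕜 : Type*} [RCLike 𝕜]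

theorem inner_toLp_indicator (w : Lp 𝕜 2 (volume : Measure ℝ)) {B : Set ℝ} (hB : MeasurableSet B)
    (z : Lp 𝕜 2 (volume.restrict B)) :
    inner 𝕜 w (((memLp_indicator_iff_restrict hB).2 (Lp.memLp z)).toLp (B.indicator z)) =
      inner 𝕜 (LpToLpRestrictCLM ℝ 𝕜 𝕜 volume 2 B w) z := by
  rw [L2.inner_def, L2.inner_def]
  calc ∫ t, inner 𝕜 (w t) (((memLp_indicator_iff_restrict hB).2 (Lp.memLp z)).toLp
          (B.indicator z) t)
      = ∫ t, B.indicator (fun t => inner 𝕜 (w t) (z t)) t := by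
        refine integral_congr_ae ?_
        filter_upwards [((memLp_indicator_iff_restrict hB).2 (Lp.memLp z)).coeFn_toLp] with t ht
        rw [ht]
        by_cases h : t ∈ B <;> simp [h]
    _ = ∫ t in B, inner 𝕜 (w t) (z t) := integral_indicator hB
    _ = _ := by
        refine integral_congr_ae ?_
        filter_upwards [LpToLpRestrictCLM_coeFn 𝕜 B w] with t ht
        rw [ht]

theorem exists_ae_eq_and_inner_wavelet_eq (ψ : Lp 𝕜 2 (volume : Measure ℝ)) {ρ : ℝ} (hρ : 0 < ρ)
    (hψ : FourierSupportedIn ψ ρ) {α β : ℝ}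
    (hframe : HasFrameBounds 𝕜 (fun p : ℤ × ℤ => wavelet ψ p.1 p.2) α β)
    {γ : ℝ} (hγ : 0 < γ)
    (hriesz : HasLowerRieszBound 𝕜 (fun p : ℤ × ℤ => wavelet ψ p.1 p.2) γ)
    {A : Set ℝ} (hA : MeasurableSet A) (hAtop : volume A < ⊤) (J : ℤ) {y : ℝ → 𝕜}
    (hy : MemLp y 2 (volume.restrict A))
    (η : lp (fun _ : {p : ℤ × ℤ // p.1 ≤ J} => 𝕜) 2) :
    ∃ x : Lp 𝕜 2 (volume : Measure ℝ), x =ᵐ[volume.restrict A] y ∧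
      ∀ p : {p : ℤ × ℤ // p.1 ≤ J}, inner 𝕜 (wavelet ψ p.1.1 p.1.2) x = η p := by
  set w : ℤ × ℤ → Lp 𝕜 2 (volume : Measure ℝ) := fun p => wavelet ψ p.1 p.2 with hw
  set T := LpToLpRestrictCLM ℝ 𝕜 𝕜 volume 2 Aᶜ with hT
  have hymem := (memLp_indicator_iff_restrict hA).2 hy
  set Y : Lp 𝕜 2 (volume : Measure ℝ) := hymem.toLp (A.indicator y) with hY
  obtain ⟨δ, hδ, hδle⟩ :=
    exists_pos_mul_norm_le_of_mem_bandLimited (𝕜 := 𝕜) ((2 : ℝ) ^ J * ρ) hA hAtop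
  have hband : ∀ p : {p : ℤ × ℤ // p.1 ≤ J}, w p ∈ bandLimited 𝕜 ((2 : ℝ) ^ J * ρ) := fun p =>
    (hψ.wavelet p.1.1 p.1.2).mono
      (mul_le_mul_of_nonneg_right (zpow_le_zpow_right₀ one_le_two p.2) hρ.le)
  have hlower : ∀ c : {p : ℤ × ℤ // p.1 ≤ J} →₀ 𝕜, c.sum (fun _ a => ‖a‖ ^ 2) ≤
      γ / δ ^ 2 * ‖Finsupp.linearCombination 𝕜 (fun p : {p : ℤ × ℤ // p.1 ≤ J} => T (w p)) c‖ ^ 2 := by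
    intro c
    set s := Finsupp.linearCombination 𝕜 (fun p : {p : ℤ × ℤ // p.1 ≤ J} => w p) c with hs
    have hsT : Finsupp.linearCombination 𝕜 (fun p : {p : ℤ × ℤ // p.1 ≤ J} => T (w p)) c = T s := by
      rw [hs, Finsupp.linearCombination_apply, Finsupp.linearCombination_apply, map_finsuppSum]
      simp only [map_smul]
    have hsband : s ∈ bandLimited 𝕜 ((2 : ℝ) ^ J * ρ) :=
      Submodule.sum_mem _ fun p _ => Submodule.smul_mem _ _ (hband p)
    have h1 := hriesz.finsupp_sum_le (c.embDomain (Function.Embedding.subtype _))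
    rw [Finsupp.sum_embDomain, Finsupp.linearCombination_embDomain] at h1
    rw [hsT]
    calc c.sum (fun _ a => ‖a‖ ^ 2) ≤ γ * ‖s‖ ^ 2 := h1
      _ = γ / δ ^ 2 * (δ * ‖s‖) ^ 2 := by field_simp
      _ ≤ γ / δ ^ 2 * ‖T s‖ ^ 2 := by gcongr; exact hδle s hsband
  -- The moments left for `z` once `Y` has contributed its own.
  have hsum : Summable fun p : {p : ℤ × ℤ // p.1 ≤ J} => ‖η p - inner 𝕜 (w p) Y‖ ^ 2 := by
    have h1 : Summable fun p => ‖η p‖ ^ 2 := by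
      simpa using (lp.memℓp η).summable (by simp)
    have h2 : Summable fun p : {p : ℤ × ℤ // p.1 ≤ J} => ‖inner 𝕜 (w p) Y‖ ^ 2 :=
      (hframe Y).1.comp_injective Subtype.val_injective
    refine Summable.of_nonneg_of_le (fun p => by positivity) (fun p => ?_)
      ((h1.add h2).mul_left 2)
    calc ‖η p - inner 𝕜 (w p) Y‖ ^ 2 ≤ (‖η p‖ + ‖inner 𝕜 (w p) Y‖) ^ 2 := by
          gcongr; exact norm_sub_le _ _
      _ ≤ 2 * (‖η p‖ ^ 2 + ‖inner 𝕜 (w p) Y‖ ^ 2) := add_sq_le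
  obtain ⟨z, hz⟩ := exists_inner_eq_of_finsupp_sum_le
    (fun p : {p : ℤ × ℤ // p.1 ≤ J} => T (w p)) (by positivity) hlower _ hsum
  have hzmem := (memLp_indicator_iff_restrict hA.compl).2 (Lp.memLp z)
  refine ⟨Y + hzmem.toLp (Aᶜ.indicator z), ?_, fun p => ?_⟩
  · filter_upwards [ae_restrict_of_ae (Lp.coeFn_add Y (hzmem.toLp (Aᶜ.indicator z))),
      ae_restrict_of_ae hymem.coeFn_toLp, ae_restrict_of_ae hzmem.coeFn_toLp,
      ae_restrict_mem hA] with t h1 h2 h3 h4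
    rw [h1, Pi.add_apply, hY, h2, h3]
    simp [h4]
  · rw [inner_add_right, inner_toLp_indicator _ hA.compl]
    exact (congrArg _ (hz p)).trans (add_sub_cancel _ _)

end Interpolation

theorem mainTheorem11 {𝕜 : Type*} [RCLike 𝕜]
    (ψ : Lp 𝕜 2 (volume : Measure ℝ))
    (ρ : ℝ) (hρ : 0 < ρ) (hψ : FourierSupportedIn ψ ρ)
    (α β : ℝ) (hα : 0 < α) (hβ : 0 < β)
    (hframe : HasFrameBounds 𝕜 (fun p : ℤ × ℤ => wavelet ψ p.1 p.2) α β)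
    (γ : ℝ) (hγ : 0 < γ)
    (hriesz : HasLowerRieszBound 𝕜 (fun p : ℤ × ℤ => wavelet ψ p.1 p.2) γ)
    (A : Set ℝ) (hA : NullMeasurableSet A volume) (hA0 : 0 < volume A) (hAtop : volume A < ⊤)
    (J : ℤ)
    (y : Lp 𝕜 2 (volume.restrict A))
    (η : lp (fun _ : {p : ℤ × ℤ // p.1 ≤ J} => 𝕜) 2) :
    ∃ x : Lp 𝕜 2 (volume : Measure ℝ),
      x =ᵐ[volume.restrict A] y ∧
      ∀ p : {p : ℤ × ℤ // p.1 ≤ J}, inner 𝕜 (wavelet ψ p.1.1 p.1.2) x = η p := by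
  -- A Lebesgue measurable `A` need not be Borel; its measurable hull differs from it by a null set.
  have hr : volume.restrict (toMeasurable volume A) = volume.restrict A :=
    Measure.restrict_congr_set hA.toMeasurable_ae_eq
  obtain ⟨x, hx, hx'⟩ := exists_ae_eq_and_inner_wavelet_eq ψ hρ hψ hframe hγ hriesz
    (measurableSet_toMeasurable volume A) (by rwa [measure_toMeasurable]) J
    (y := y) (by rw [hr]; exact Lp.memLp y) η
  exact ⟨x, by rwa [hr] at hx, hx'⟩
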